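/- Let $S\subset\mathbb{R}^2$ be either the truncated parabola $P^1=\{(\xi,\xi^2):\ |\xi|\le 1/2\}$ or the unit circle $S^1=\{x\in\mathbb{R}^2:\ |x|=1\}$. For a finite set $\Lambda\subset\mathbb{R}^2$ let $$E_3(\Lambda)=\bigl|\{(\lambda_1,\ldots,\lambda_6)\in\Lambda^6:\ \lambda_1+\lambda_2+\lambda_3=\lambda_4+\lambda_5+\lambda_6\}\bigr|$$ be its $3$-energy. Then for every $\epsilon>0$ there is a constant $C_\epsilon>0$, depending only on $\epsilon$, such that for every finite set $\Lambda\subset S$ $$E_3(\Lambda)\le C_\epsilon\,|\Lambda|^{\frac72+\epsilon}.$$ -/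

import Mathlib

/-- The `k`-energy of a finite set `Λ ⊂ ℝⁿ`: the number of `2k`-tuples of elements of `Λ`,
written as pairs of `k`-tuples, whose two halves have the same sum. -/
noncomputable def kEnergy {n : ℕ} (k : ℕ) (Λ : Finset (EuclideanSpace ℝ (Fin n))) : ℕ :=
  Set.ncard {p : (Fin k → EuclideanSpace ℝ (Fin n)) × (Fin k → EuclideanSpace ℝ (Fin n)) |
    (∀ i, p.1 i ∈ Λ) ∧ (∀ i, p.2 i ∈ Λ) ∧ ∑ i, p.1 i = ∑ i, p.2 i}

/-- The truncated parabola `P¹ = {(ξ, ξ²) : |ξ| ≤ 1/2}` in the plane. -/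
def truncatedParabola : Set (EuclideanSpace ℝ (Fin 2)) :=
  {x | |x 0| ≤ 1 / 2 ∧ x 1 = x 0 ^ 2}

/-- The unit circle `S¹` in the plane. -/
def unitCircle : Set (EuclideanSpace ℝ (Fin 2)) :=
  Metric.sphere 0 1

/-!
Let `A` be a set of `N` abscissae on the graph of a strictly convex function, and let `x ≠ y` be
nondecreasing triples in `A` giving the same sum of points of the graph. Neither of them majorizes
the other, so both ends of the triple move in the same direction from `x` to `y`. Cut `A` into about
`√N` blocks of consecutive elements and colour a triple by the sum of the block indices of its ends:
if `x` and `y` have the same colour, then their ends lie in the same blocks. Moreover the ends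
determine the middle entries, because a chord of a strictly convex graph is determined by its
displacement. So there are at most `N³ + (N√N)²` collisions within the colour classes, and
Cauchy–Schwarz over the `O(√N)` colours bounds the energy by `O(N^{7/2})`.

The parabola is such a graph and the circle is a union of two of them; for unions, two further
applications of Cauchy–Schwarz bound the mixed energies by the energies of the pieces.
-/

open Finset

section Coincidences

variable {α β γ δ : Type*}

open scoped Classical in
/-- The pairs in `P × R` on which the labellings `φ` of `P` and `ψ` of `R` agree. Energies are
cardinalities of such sets. -/
noncomputable def coincidences (P : Finset α) (φ : α → γ) (R : Finset β) (ψ : β → γ) :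
    Finset (α × β) :=
  {p ∈ P ×ˢ R | φ p.1 = ψ p.2}

/-- The ordered pairs in `P × P`, equal entries included, on which the labelling `φ` agrees. -/
noncomputable abbrev collisions (P : Finset α) (φ : α → γ) : Finset (α × α) :=
  coincidences P φ P φ

theorem mem_coincidences {P : Finset α} {φ : α → γ} {R : Finset β} {ψ : β → γ} {p : α × β} :
    p ∈ coincidences P φ R ψ ↔ (p.1 ∈ P ∧ p.2 ∈ R) ∧ φ p.1 = ψ p.2 := by
  simp only [coincidences, mem_filter, mem_product]

theorem card_coincidences_eq_sum [DecidableEq γ] {P : Finset α} {φ : α → γ} {R : Finset β}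
    {ψ : β → γ} {X : Finset γ} (hX : ∀ p ∈ P, φ p ∈ X) :
    #(coincidences P φ R ψ) = ∑ x ∈ X, #{p ∈ P | φ p = x} * #{r ∈ R | ψ r = x} := by
  rw [card_eq_sum_card_fiberwise (f := fun p : α × β => φ p.1) (t := X)
    fun p hp => hX _ (mem_coincidences.1 hp).1.1]
  refine sum_congr rfl fun x _ => ?_
  rw [← card_product]
  congr 1
  ext p
  simp only [mem_filter, mem_product, mem_coincidences]
  grind

theorem card_coincidences_sq_le (P : Finset α) (φ : α → γ) (R : Finset β) (ψ : β → γ) :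
    #(coincidences P φ R ψ) ^ 2 ≤ #(collisions P φ) * #(collisions R ψ) := by
  classical
  have hP : ∀ p ∈ P, φ p ∈ P.image φ ∪ R.image ψ := fun p hp =>
    mem_union_left _ (mem_image_of_mem _ hp)
  have hR : ∀ r ∈ R, ψ r ∈ P.image φ ∪ R.image ψ := fun r hr =>
    mem_union_right _ (mem_image_of_mem _ hr)
  simp only [collisions, card_coincidences_eq_sum hP, card_coincidences_eq_sum hR, ← sq]
  exact sum_mul_sq_le_sq_mul_sq _ _ _

theorem card_collisions_le_mul_sum [DecidableEq δ] {P : Finset α} (φ : α → γ) {c : α → δ}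
    {K : Finset δ} (hK : ∀ p ∈ P, c p ∈ K) :
    #(collisions P φ) ≤ #K * ∑ k ∈ K, #(collisions {p ∈ P | c p = k} φ) := by
  classical
  have hφ (k : δ) : ∀ p ∈ ({p ∈ P | c p = k} : Finset α), φ p ∈ P.image φ := fun p hp =>
    mem_image_of_mem _ (mem_filter.1 hp).1
  have hfiber (x : γ) : #{p ∈ P | φ p = x} = ∑ k ∈ K, #{p ∈ {p ∈ P | c p = k} | φ p = x} := by
    rw [card_eq_sum_card_fiberwise fun p hp => hK p (mem_filter.1 hp).1]
    simp only [filter_filter, and_comm]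
  calc #(collisions P φ)
      = ∑ x ∈ P.image φ, (∑ k ∈ K, #{p ∈ {p ∈ P | c p = k} | φ p = x}) ^ 2 := by
        simp only [collisions, card_coincidences_eq_sum fun _ hp => mem_image_of_mem φ hp, hfiber,
          ← sq]
    _ ≤ ∑ x ∈ P.image φ, #K * ∑ k ∈ K, #{p ∈ {p ∈ P | c p = k} | φ p = x} ^ 2 :=
        sum_le_sum fun x _ => mod_cast sq_sum_le_card_mul_sum_sq
    _ = #K * ∑ k ∈ K, #(collisions {p ∈ P | c p = k} φ) := by
        rw [← mul_sum, sum_comm]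
        simp only [collisions, card_coincidences_eq_sum (hφ _), ← sq]

theorem sum_card_collisions_filter [DecidableEq δ] {P : Finset α} (φ : α → γ) {c : α → δ}
    {K : Finset δ} (hK : ∀ p ∈ P, c p ∈ K) :
    ∑ k ∈ K, #(collisions {p ∈ P | c p = k} φ) = #(collisions P fun p => (φ p, c p)) := by
  rw [card_eq_sum_card_fiberwise (f := fun p : α × α => c p.1)
    fun p hp => hK _ (mem_coincidences.1 hp).1.1]
  refine sum_congr rfl fun k _ => congrArg card ?_
  ext p
  simp only [mem_coincidences, mem_filter, Prod.mk.injEq]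
  grind

theorem card_coincidences_le_card_mul_of_card_fiber_le [DecidableEq γ] (P : Finset α) (φ : α → γ)
    {R : Finset β} {ψ : β → γ} {q : ℕ} (hq : ∀ x, #{r ∈ R | ψ r = x} ≤ q) :
    #(coincidences P φ R ψ) ≤ #P * q := by
  rw [card_coincidences_eq_sum fun p hp => mem_image_of_mem φ hp,
    card_eq_sum_card_image φ P, sum_mul]
  exact sum_le_sum fun x _ => Nat.mul_le_mul_left _ (hq x)

theorem card_collisions_le_of_injOn {P : Finset α} {φ : α → γ} {R : Finset β} {ψ : β → δ}
    (e : α → β) (hmaps : Set.MapsTo e P R) (hinj : Set.InjOn e P)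
    (hlabel : ∀ p ∈ P, ∀ q ∈ P, φ p = φ q → ψ (e p) = ψ (e q)) :
    #(collisions P φ) ≤ #(collisions R ψ) := by
  refine card_le_card_of_injOn (Prod.map e e) (fun p hp => ?_)
    ((hinj.prodMap hinj).mono fun p hp => (mem_coincidences.1 hp).1)
  obtain ⟨⟨h₁, h₂⟩, h⟩ := mem_coincidences.1 hp
  exact mem_coincidences.2 ⟨⟨hmaps h₁, hmaps h₂⟩, hlabel _ h₁ _ h₂ h⟩

theorem card_collisions_eq_card_add_offDiag [DecidableEq γ] (P : Finset α) (φ : α → γ) :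
    #(collisions P φ) = #P + #{p ∈ P.offDiag | φ p.1 = φ p.2} := by
  classical
  have hdiag : ({p ∈ collisions P φ | p.1 = p.2} : Finset (α × α)) = P.diag := by
    ext p
    simp only [mem_filter, mem_coincidences, mem_diag]
    grind
  have hoff : ({p ∈ collisions P φ | ¬p.1 = p.2} : Finset (α × α)) =
      {p ∈ P.offDiag | φ p.1 = φ p.2} := by
    ext p
    simp only [mem_filter, mem_coincidences, mem_offDiag]
    grind
  rw [← card_filter_add_card_filter_not fun p : α × α => p.1 = p.2, hdiag, hoff, diag_card]

end Coincidences

section SortedTuples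

variable {α γ : Type*} [LinearOrder α] {n : ℕ}

/-- The nondecreasing `n`-tuples of elements of `A`. -/
def sortedTuples (n : ℕ) (A : Finset α) : Finset (Fin n → α) :=
  {x ∈ Fintype.piFinset fun _ => A | Monotone x}

theorem mem_sortedTuples {A : Finset α} {x : Fin n → α} :
    x ∈ sortedTuples n A ↔ (∀ i, x i ∈ A) ∧ Monotone x := by
  simp only [sortedTuples, mem_filter, Fintype.mem_piFinset]

theorem card_sortedTuples_le (n : ℕ) (A : Finset α) : #(sortedTuples n A) ≤ #A ^ n :=
  (card_filter_le _ _).trans_eq (Fintype.card_piFinset_const A n)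

theorem card_collisions_piFinset_le_sortedTuples (A : Finset α) {φ : (Fin n → α) → γ}
    (hφ : ∀ x (σ : Equiv.Perm (Fin n)), φ (x ∘ σ) = φ x) :
    #(collisions (Fintype.piFinset fun _ : Fin n => A) φ) ≤
      n.factorial ^ 2 * #(collisions (sortedTuples n A) φ) := by
  have hperm : #(univ : Finset (Equiv.Perm (Fin n) × Equiv.Perm (Fin n))) = n.factorial ^ 2 := by
    rw [card_univ, Fintype.card_prod, Fintype.card_perm, Fintype.card_fin, sq]
  have hsort : ∀ x ∈ Fintype.piFinset fun _ : Fin n => A, x ∘ Tuple.sort x ∈ sortedTuples n A :=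
    fun x hx => mem_sortedTuples.2 ⟨fun _ => Fintype.mem_piFinset.1 hx _, Tuple.monotone_sort x⟩
  rw [← hperm, ← card_product]
  refine card_le_card_of_injOn (fun p =>
    ((Tuple.sort p.1, Tuple.sort p.2), (p.1 ∘ Tuple.sort p.1, p.2 ∘ Tuple.sort p.2))) ?_ ?_
  · rintro ⟨x, y⟩ h
    obtain ⟨⟨hx, hy⟩, hxy⟩ := mem_coincidences.1 h
    refine mem_product.2 ⟨mem_univ _, mem_coincidences.2 ⟨⟨hsort x hx, hsort y hy⟩, ?_⟩⟩
    simpa only [hφ] using hxy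
  · rintro ⟨x, y⟩ - ⟨x', y'⟩ - h
    simp only [Prod.mk.injEq] at h ⊢
    obtain ⟨⟨hσ, hτ⟩, hx, hy⟩ := h
    rw [← hσ] at hx
    rw [← hτ] at hy
    exact ⟨(Tuple.sort x).surjective.injective_comp_right hx,
      (Tuple.sort y).surjective.injective_comp_right hy⟩

end SortedTuples

section MixedEnergy

variable {G : Type*} [AddCommGroup G]

/-- The mixed energy of three finite sets: the number of solutions of
`x₀ + x₁ + x₂ = y₀ + y₁ + y₂` with `xᵢ, yᵢ ∈ C i`. -/
noncomputable def mixedEnergy (C : Fin 3 → Finset G) : ℕ :=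
  #(collisions (Fintype.piFinset C) fun x => ∑ i, x i)

theorem mem_piFinset_vec_three {α : Type*} {A B C : Finset α} {x : Fin 3 → α} :
    x ∈ Fintype.piFinset ![A, B, C] ↔ x 0 ∈ A ∧ x 1 ∈ B ∧ x 2 ∈ C := by
  simp [Fin.forall_fin_succ]

theorem mixedEnergy_le_card_coincidences (A B C : Finset G) :
    mixedEnergy ![A, B, C] ≤ #(coincidences (A ×ˢ A ×ˢ B) (fun p => p.1 - p.2.1 + p.2.2)
      (C ×ˢ C ×ˢ B) fun p => p.1 - p.2.1 + p.2.2) := by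
  refine card_le_card_of_injOn
    (fun p => ((p.1 0, p.2 0, p.1 1), (p.2 2, p.1 2, p.2 1))) ?_ ?_
  · rintro ⟨x, y⟩ h
    simp only [mem_coe, mem_coincidences, mem_piFinset_vec_three, mem_product,
      Fin.sum_univ_three] at h ⊢
    grind
  · rintro ⟨x, y⟩ - ⟨x', y'⟩ - h
    simp only [Prod.mk.injEq, funext_iff, Fin.forall_fin_succ] at h ⊢
    grind

theorem card_collisions_sub_add_le_mixedEnergy (A B : Finset G) :
    #(collisions (A ×ˢ A ×ˢ B) fun p => p.1 - p.2.1 + p.2.2) ≤ mixedEnergy ![A, A, B] := by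
  refine card_le_card_of_injOn
    (fun p => (![p.1.1, p.2.2.1, p.1.2.2], ![p.2.1, p.1.2.1, p.2.2.2])) ?_ ?_
  · rintro ⟨⟨a, b, c⟩, ⟨a', b', c'⟩⟩ h
    simp only [mem_coe, mem_coincidences, mem_piFinset_vec_three, mem_product, Fin.sum_univ_three,
      Matrix.cons_val] at h ⊢
    grind
  · rintro ⟨⟨a, b, c⟩, ⟨a', b', c'⟩⟩ - ⟨⟨x, y, z⟩, ⟨x', y', z'⟩⟩ - h
    simp only [Prod.mk.injEq, Matrix.vecCons_inj] at h ⊢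
    tauto

theorem mixedEnergy_sq_le (A B C : Finset G) :
    mixedEnergy ![A, B, C] ^ 2 ≤ mixedEnergy ![A, A, B] * mixedEnergy ![C, C, B] :=
  calc mixedEnergy ![A, B, C] ^ 2
      ≤ #(coincidences (A ×ˢ A ×ˢ B) (fun p => p.1 - p.2.1 + p.2.2)
          (C ×ˢ C ×ˢ B) fun p => p.1 - p.2.1 + p.2.2) ^ 2 :=
        Nat.pow_le_pow_left (mixedEnergy_le_card_coincidences A B C) 2
    _ ≤ _ := card_coincidences_sq_le _ _ _ _
    _ ≤ mixedEnergy ![A, A, B] * mixedEnergy ![C, C, B] :=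
        Nat.mul_le_mul (card_collisions_sub_add_le_mixedEnergy A B)
          (card_collisions_sub_add_le_mixedEnergy C B)

theorem mixedEnergy_le_of_forall_le {C : Fin 3 → Finset G} {M : ℕ}
    (hM : ∀ i, mixedEnergy (fun _ => C i) ≤ M) : mixedEnergy C ≤ M := by
  have hconst (A : Finset G) : (fun _ : Fin 3 => A) = ![A, A, A] := by
    ext i : 1
    fin_cases i <;> rfl
  have hpair {A B : Finset G} (hA : mixedEnergy (fun _ => A) ≤ M)
      (hB : mixedEnergy (fun _ => B) ≤ M) : mixedEnergy ![A, A, B] ≤ M := by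
    rw [hconst] at hA hB
    have hAAB := mixedEnergy_sq_le A A B
    have hBBA := mixedEnergy_sq_le B B A
    by_contra! h
    rcases le_total (mixedEnergy ![A, A, B]) (mixedEnergy ![B, B, A]) <;> nlinarith
  have hsq := mixedEnergy_sq_le (C 0) (C 1) (C 2)
  have hC : C = ![C 0, C 1, C 2] := by
    ext i : 1
    fin_cases i <;> rfl
  rw [← hC] at hsq
  nlinarith [hpair (hM 0) (hM 1), hpair (hM 2) (hM 1)]

theorem mixedEnergy_le_of_fibers_le {ι : Type*} [Fintype ι] [DecidableEq ι] {Λ : Finset G}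
    (c : G → ι) {M : ℕ} (hM : ∀ i, mixedEnergy (fun _ => {x ∈ Λ | c x = i}) ≤ M) :
    mixedEnergy (fun _ => Λ) ≤ Fintype.card ι ^ 6 * M := by
  have hfiber (P : Fin 3 → ι) :
      ({x ∈ Fintype.piFinset fun _ : Fin 3 => Λ | c ∘ x = P} : Finset (Fin 3 → G)) =
        Fintype.piFinset fun i => {x ∈ Λ | c x = P i} := by
    ext x
    simp only [mem_filter, Fintype.mem_piFinset, funext_iff, Function.comp_apply, forall_and]
  have hcard : #(univ : Finset (Fin 3 → ι)) = Fintype.card ι ^ 3 := by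
    rw [card_univ, Fintype.card_fun, Fintype.card_fin]
  calc mixedEnergy (fun _ => Λ)
      ≤ #(univ : Finset (Fin 3 → ι)) *
          ∑ P : Fin 3 → ι, mixedEnergy fun i => {x ∈ Λ | c x = P i} := by
        simp only [mixedEnergy, ← hfiber]
        exact card_collisions_le_mul_sum _ fun _ _ => mem_univ _
    _ ≤ #(univ : Finset (Fin 3 → ι)) * (#(univ : Finset (Fin 3 → ι)) * M) :=
        Nat.mul_le_mul_left _ <| sum_le_card_nsmul _ _ _ fun P _ =>
          mixedEnergy_le_of_forall_le fun i => hM (P i)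
    _ = Fintype.card ι ^ 6 * M := by
        rw [hcard]
        ring

end MixedEnergy

section StrictConvexity

theorem smul_add_smul_eq_of_add_eq_add {R E : Type*} [CommRing R] [AddCommGroup E] [Module R E]
    {a b d : E} {l r : R} (hlr : l + r = 1) (hsum : l • a + r • b + d = a + b) :
    r • a + l • b = d := by
  obtain rfl : r = 1 - l := eq_sub_of_add_eq' hlr
  rw [eq_sub_of_add_eq' hsum]
  module

variable {𝕜 E : Type*} [Field 𝕜] [LinearOrder 𝕜] [IsStrictOrderedRing 𝕜]

section Segment

variable [AddCommGroup E] [Module 𝕜 E] {s : Set E} {f : E → 𝕜} {a b c d : E}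

theorem add_le_add_of_convexOn (hf : ConvexOn 𝕜 s f) (ha : a ∈ s) (hb : b ∈ s)
    (hc : c ∈ segment 𝕜 a b) (hsum : c + d = a + b) : f c + f d ≤ f a + f b := by
  obtain ⟨l, r, hl, hr, hlr, rfl⟩ := hc
  obtain rfl := smul_add_smul_eq_of_add_eq_add hlr hsum
  have hc := hf.2 ha hb hl hr hlr
  have hd := hf.2 ha hb hr hl ((add_comm r l).trans hlr)
  calc _ ≤ _ := add_le_add hc hd
    _ = f a + f b := by
      simp only [smul_eq_mul]
      linear_combination (f a + f b) * hlr

theorem add_lt_add_of_strictConvexOn (hf : StrictConvexOn 𝕜 s f) (ha : a ∈ s) (hb : b ∈ s)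
    (hab : a ≠ b) (hc : c ∈ openSegment 𝕜 a b) (hsum : c + d = a + b) :
    f c + f d < f a + f b := by
  obtain ⟨l, r, hl, hr, hlr, rfl⟩ := hc
  obtain rfl := smul_add_smul_eq_of_add_eq_add hlr hsum
  have hc := hf.2 ha hb hab hl hr hlr
  have hd := hf.2 ha hb hab hr hl ((add_comm r l).trans hlr)
  calc _ < _ := add_lt_add hc hd
    _ = f a + f b := by
      simp only [smul_eq_mul]
      linear_combination (f a + f b) * hlr

theorem eq_or_eq_of_strictConvexOn_of_add_le (hf : StrictConvexOn 𝕜 s f) (ha : a ∈ s) (hb : b ∈ s)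
    (hc : c ∈ segment 𝕜 a b) (hsum : c + d = a + b) (hfsum : f a + f b ≤ f c + f d) :
    c = a ∨ c = b := by
  by_contra! hne
  have hab : a ≠ b := by
    rintro rfl
    rw [segment_same] at hc
    exact hne.1 hc
  exact hfsum.not_gt <| add_lt_add_of_strictConvexOn hf ha hb hab
    (mem_openSegment_of_ne_left_right hne.1.symm hne.2.symm hc) hsum

theorem eq_or_eq_of_two_transfers (hf : StrictConvexOn 𝕜 s f) {m z w p r : E} (ha : a ∈ s)
    (hm : m ∈ s) (hb : b ∈ s) (hz : z ∈ segment 𝕜 a b) (hzw : z + w = a + b)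
    (hp : p ∈ segment 𝕜 z m) (hpr : p + r = z + m)
    (hfsum : f a + f m + f b ≤ f w + f p + f r) : (z = a ∨ z = b) ∧ (p = z ∨ p = m) := by
  have hzs : z ∈ s := hf.1.segment_subset ha hb hz
  have houter : f z + f w ≤ f a + f b := add_le_add_of_convexOn hf.convexOn ha hb hz hzw
  have hinner : f p + f r ≤ f z + f m := add_le_add_of_convexOn hf.convexOn hzs hm hp hpr
  exact ⟨eq_or_eq_of_strictConvexOn_of_add_le hf ha hb hz hzw (by linarith),
    eq_or_eq_of_strictConvexOn_of_add_le hf hzs hm hp hpr (by linarith)⟩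

end Segment

variable {I : Set 𝕜} {f : 𝕜 → 𝕜}

theorem eq_of_sub_eq_sub_of_strictConvexOn (hf : StrictConvexOn 𝕜 I f) {u u' v v' : 𝕜}
    (hu : u ∈ I) (hu' : u' ∈ I) (hv : v ∈ I) (hv' : v' ∈ I) (hne : u ≠ u') (h : u - u' = v - v')
    (hfe : f u - f u' = f v - f v') : u = v := by
  wlog huu' : u < u' generalizing u u' v v'
  · have := this hu' hu hv' hv hne.symm (by linarith) (by linarith)
      (lt_of_le_of_ne (not_lt.1 huu') hne.symm)
    linarith
  wlog huv : u ≤ v generalizing u u' v v'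
  · exact (this hv hv' hu hu' (by grind) h.symm hfe.symm (by linarith) (le_of_not_ge huv)).symm
  have := eq_or_eq_of_strictConvexOn_of_add_le hf hu hv' (c := v) (d := u')
    (Icc_subset_segment ⟨huv, by linarith⟩) (by linarith) (by linarith)
  grind

variable {x y : Fin 3 → 𝕜}

/-- Moving the outer two entries of `x` towards each other, and then the middle entry towards one
of them, turns `x` into `y`; each move can only decrease the sum of `f`. -/
theorem eq_of_majorizes_of_strictConvexOn (hf : StrictConvexOn 𝕜 I f) (hx : ∀ i, x i ∈ I)
    (hym : Monotone y) (hsum : ∑ i, x i = ∑ i, y i) (hfsum : ∑ i, f (x i) = ∑ i, f (y i))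
    (h₀ : x 0 ≤ y 0) (h₂ : y 2 ≤ x 2) : x = y := by
  rw [Fin.sum_univ_three, Fin.sum_univ_three] at hsum hfsum
  have hy₀₁ : y 0 ≤ y 1 := hym (by decide)
  have hy₁₂ : y 1 ≤ y 2 := hym (by decide)
  suffices hends : x 0 = y 0 ∧ x 2 = y 2 by
    ext i
    fin_cases i
    exacts [hends.1, by change x 1 = y 1; linarith, hends.2]
  rcases le_total (x 0 + x 2) (y 0 + y 2) with h | h
  · have houter : x 0 + x 2 - y 2 ∈ segment 𝕜 (x 0) (x 2) :=
      Icc_subset_segment ⟨by linarith, by linarith⟩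
    have hinner : y 0 ∈ segment 𝕜 (x 0 + x 2 - y 2) (x 1) :=
      Icc_subset_segment ⟨by linarith, by linarith⟩
    obtain ⟨hz | hz, hy | hy⟩ := eq_or_eq_of_two_transfers hf (hx 0) (hx 1) (hx 2) houter
        (w := y 2) (by linarith) hinner (r := y 1) (by linarith) (by linarith) <;>
      constructor <;> linarith
  · have houter : x 0 + x 2 - y 0 ∈ segment 𝕜 (x 0) (x 2) :=
      Icc_subset_segment ⟨by linarith, by linarith⟩
    have hinner : y 2 ∈ segment 𝕜 (x 0 + x 2 - y 0) (x 1) :=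
      segment_symm 𝕜 (x 1) _ ▸ Icc_subset_segment ⟨by linarith, by linarith⟩
    obtain ⟨hz | hz, hy | hy⟩ := eq_or_eq_of_two_transfers hf (hx 0) (hx 1) (hx 2) houter
        (w := y 0) (by linarith) hinner (r := y 1) (by linarith) (by linarith) <;>
      constructor <;> linarith

theorem ends_lt_or_gt_of_strictConvexOn (hf : StrictConvexOn 𝕜 I f) (hx : ∀ i, x i ∈ I)
    (hy : ∀ i, y i ∈ I) (hxm : Monotone x) (hym : Monotone y) (hsum : ∑ i, x i = ∑ i, y i)
    (hfsum : ∑ i, f (x i) = ∑ i, f (y i)) (hne : x ≠ y) :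
    (x 0 < y 0 ∧ x 2 < y 2) ∨ (y 0 < x 0 ∧ y 2 < x 2) := by
  have hxy : x 0 ≤ y 0 → x 2 < y 2 := fun h₀ => by
    by_contra! h₂
    exact hne (eq_of_majorizes_of_strictConvexOn hf hx hym hsum hfsum h₀ h₂)
  have hyx : y 0 ≤ x 0 → y 2 < x 2 := fun h₀ => by
    by_contra! h₂
    exact hne (eq_of_majorizes_of_strictConvexOn hf hy hxm hsum.symm hfsum.symm h₀ h₂).symm
  rcases lt_trichotomy (x 0) (y 0) with h₀ | h₀ | h₀
  · exact Or.inl ⟨h₀, hxy h₀.le⟩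
  · exact absurd (hxy h₀.le) (hyx h₀.ge).not_gt
  · exact Or.inr ⟨h₀, hyx h₀.le⟩

theorem eq_and_eq_of_ends_eq_of_strictConvexOn (hf : StrictConvexOn 𝕜 I f) {x' y' : Fin 3 → 𝕜}
    (hx : x 1 ∈ I) (hy : y 1 ∈ I) (hx' : x' 1 ∈ I) (hy' : y' 1 ∈ I)
    (hsum : ∑ i, x i = ∑ i, y i) (hfsum : ∑ i, f (x i) = ∑ i, f (y i))
    (hsum' : ∑ i, x' i = ∑ i, y' i) (hfsum' : ∑ i, f (x' i) = ∑ i, f (y' i))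
    (hx₀ : x 0 = x' 0) (hx₂ : x 2 = x' 2) (hy₀ : y 0 = y' 0) (hy₂ : y 2 = y' 2)
    (hne : x 0 + x 2 ≠ y 0 + y 2) : x = x' ∧ y = y' := by
  simp only [Fin.sum_univ_three, ← hx₀, ← hx₂, ← hy₀, ← hy₂] at hsum hfsum hsum' hfsum'
  have hx₁ : x 1 = x' 1 := eq_of_sub_eq_sub_of_strictConvexOn hf hx hy hx' hy'
    (fun h => hne (by linarith)) (by linarith) (by linarith)
  have hy₁ : y 1 = y' 1 := by linarith
  constructor <;> ext i <;> fin_cases i <;> assumption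

end StrictConvexity

section Blocks

variable {α : Type*} [LinearOrder α]

/-- The index of the block containing `a` when `A` is cut, in increasing order, into blocks of `q`
consecutive elements. -/
def blockIndex (A : Finset α) (q : ℕ) (a : α) : ℕ := #{b ∈ A | b < a} / q

theorem monotone_blockIndex (A : Finset α) (q : ℕ) : Monotone (blockIndex A q) := fun _ _ hab =>
  Nat.div_le_div_right <| card_le_card <| monotone_filter_right A fun _ _ hc => hc.trans_le hab

theorem blockIndex_le (A : Finset α) (q : ℕ) (a : α) : blockIndex A q a ≤ #A / q :=
  Nat.div_le_div_right (card_filter_le _ _)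

theorem strictMonoOn_card_filter_lt (A : Finset α) :
    StrictMonoOn (fun a => #{b ∈ A | b < a}) (A : Set α) := fun a ha _ _ hab =>
  card_lt_card <| ssubset_iff_of_subset
    (monotone_filter_right A fun _ _ hc => hc.trans hab) |>.2
    ⟨a, mem_filter.2 ⟨ha, hab⟩, fun h => lt_irrefl a (mem_filter.1 h).2⟩

theorem card_filter_blockIndex_eq_le (A : Finset α) {q : ℕ} (hq : 0 < q) (k : ℕ) :
    #{a ∈ A | blockIndex A q a = k} ≤ q :=
  calc #{a ∈ A | blockIndex A q a = k} ≤ #(Ico (k * q) (k * q + q)) := by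
        refine card_le_card_of_injOn (fun a => #{b ∈ A | b < a}) (fun a ha => ?_)
          ((strictMonoOn_card_filter_lt A).injOn.mono fun a ha => (mem_filter.1 ha).1)
        rw [mem_coe, mem_Ico, ← (mem_filter.1 ha).2]
        exact ⟨Nat.div_mul_le_self _ _, Nat.lt_div_mul_add hq⟩
    _ = q := by rw [Nat.card_Ico, Nat.add_sub_cancel_left]

theorem card_collisions_blockIndex_le (A : Finset α) {q : ℕ} (hq : 0 < q) :
    #(collisions A (blockIndex A q)) ≤ #A * q :=
  card_coincidences_le_card_mul_of_card_fiber_le A _ (card_filter_blockIndex_eq_le A hq)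

/-- The sum of the block indices of the two ends of a triple. The ends of colliding triples move in
the same direction, so for these the sum determines both indices. -/
def endsIndex (A : Finset α) (q : ℕ) (x : Fin 3 → α) : ℕ :=
  blockIndex A q (x 0) + blockIndex A q (x 2)

theorem endsIndex_mem_range (A : Finset α) (q : ℕ) (x : Fin 3 → α) :
    endsIndex A q x ∈ range (2 * (#A / q) + 1) := by
  have h₀ := blockIndex_le A q (x 0)
  have h₂ := blockIndex_le A q (x 2)
  rw [mem_range, endsIndex]
  omega

end Blocks

section GraphSums

variable {𝕜 : Type*} [Field 𝕜]

/-- The sum of `n` points of the graph of `f`, given by their abscissae. -/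
def graphSum (f : 𝕜 → 𝕜) {n : ℕ} (x : Fin n → 𝕜) : 𝕜 × 𝕜 := (∑ i, x i, ∑ i, f (x i))

theorem graphSum_comp_perm (f : 𝕜 → 𝕜) {n : ℕ} (x : Fin n → 𝕜) (σ : Equiv.Perm (Fin n)) :
    graphSum f (x ∘ σ) = graphSum f x :=
  Prod.ext (Equiv.sum_comp σ x) (Equiv.sum_comp σ fun i => f (x i))

variable [LinearOrder 𝕜] [IsStrictOrderedRing 𝕜] {I : Set 𝕜} {f : 𝕜 → 𝕜} {A : Finset 𝕜}

theorem ends_lt_or_gt_of_graphSum_eq (hf : StrictConvexOn 𝕜 I f) (hA : (A : Set 𝕜) ⊆ I)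
    {x y : Fin 3 → 𝕜} (hx : x ∈ sortedTuples 3 A) (hy : y ∈ sortedTuples 3 A) (hne : x ≠ y)
    (hxy : graphSum f x = graphSum f y) :
    (x 0 < y 0 ∧ x 2 < y 2) ∨ (y 0 < x 0 ∧ y 2 < x 2) := by
  obtain ⟨hxA, hxm⟩ := mem_sortedTuples.1 hx
  obtain ⟨hyA, hym⟩ := mem_sortedTuples.1 hy
  obtain ⟨hsum, hfsum⟩ := Prod.mk.inj hxy
  exact ends_lt_or_gt_of_strictConvexOn hf (fun i => hA (hxA i)) (fun i => hA (hyA i)) hxm hym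
    hsum hfsum hne

theorem blockIndex_ends_eq (hf : StrictConvexOn 𝕜 I f) (hA : (A : Set 𝕜) ⊆ I) {q : ℕ}
    {x y : Fin 3 → 𝕜} (hx : x ∈ sortedTuples 3 A) (hy : y ∈ sortedTuples 3 A) (hne : x ≠ y)
    (hxy : graphSum f x = graphSum f y) (hindex : endsIndex A q x = endsIndex A q y) :
    blockIndex A q (x 0) = blockIndex A q (y 0) ∧ blockIndex A q (x 2) = blockIndex A q (y 2) := by
  have hmono := monotone_blockIndex A q
  unfold endsIndex at hindex
  rcases ends_lt_or_gt_of_graphSum_eq hf hA hx hy hne hxy with ⟨h₀, h₂⟩ | ⟨h₀, h₂⟩ <;>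
  · have := hmono h₀.le
    have := hmono h₂.le
    omega

theorem injOn_ends_of_graphSum_eq (hf : StrictConvexOn 𝕜 I f) (hA : (A : Set 𝕜) ⊆ I) :
    Set.InjOn (fun p : (Fin 3 → 𝕜) × (Fin 3 → 𝕜) => ((p.1 0, p.2 0), (p.1 2, p.2 2)))
      {p | p ∈ (sortedTuples 3 A).offDiag ∧ graphSum f p.1 = graphSum f p.2} := by
  rintro ⟨x, y⟩ ⟨hxy, hs⟩ ⟨x', y'⟩ ⟨hxy', hs'⟩ hends
  obtain ⟨hx, hy, hne⟩ := mem_offDiag.1 hxy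
  obtain ⟨hx', hy', -⟩ := mem_offDiag.1 hxy'
  obtain ⟨hsum, hfsum⟩ := Prod.mk.inj hs
  obtain ⟨hsum', hfsum'⟩ := Prod.mk.inj hs'
  simp only [Prod.mk.injEq] at hends
  obtain ⟨⟨hx₀, hy₀⟩, hx₂, hy₂⟩ := hends
  have hI {z : Fin 3 → 𝕜} (hz : z ∈ sortedTuples 3 A) : z 1 ∈ I := hA ((mem_sortedTuples.1 hz).1 1)
  have hends_ne : x 0 + x 2 ≠ y 0 + y 2 := by
    rcases ends_lt_or_gt_of_graphSum_eq hf hA hx hy hne hs with ⟨h₀, h₂⟩ | ⟨h₀, h₂⟩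
    exacts [(add_lt_add h₀ h₂).ne, (add_lt_add h₀ h₂).ne']
  exact Prod.ext_iff.2 <| eq_and_eq_of_ends_eq_of_strictConvexOn hf (hI hx) (hI hy) (hI hx')
    (hI hy') hsum hfsum hsum' hfsum' hx₀ hx₂ hy₀ hy₂ hends_ne

theorem card_offDiag_sortedTuples_le (hf : StrictConvexOn 𝕜 I f) (hA : (A : Set 𝕜) ⊆ I) {q : ℕ}
    (hq : 0 < q) :
    #{p ∈ (sortedTuples 3 A).offDiag |
      (graphSum f p.1, endsIndex A q p.1) = (graphSum f p.2, endsIndex A q p.2)} ≤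
      (#A * q) ^ 2 :=
  calc _ ≤ #(collisions A (blockIndex A q) ×ˢ collisions A (blockIndex A q)) := by
        refine card_le_card_of_injOn (fun p => ((p.1 0, p.2 0), (p.1 2, p.2 2))) ?_
          ((injOn_ends_of_graphSum_eq hf hA).mono fun p hp => ?_)
        · rintro ⟨x, y⟩ hp
          obtain ⟨hxy, hlabel⟩ := mem_filter.1 hp
          obtain ⟨hx, hy, hne⟩ := mem_offDiag.1 hxy
          obtain ⟨hsum, hindex⟩ := Prod.mk.inj hlabel
          obtain ⟨h₀, h₂⟩ := blockIndex_ends_eq hf hA hx hy hne hsum hindex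
          have hxA := (mem_sortedTuples.1 hx).1
          have hyA := (mem_sortedTuples.1 hy).1
          exact mem_product.2 ⟨mem_coincidences.2 ⟨⟨hxA 0, hyA 0⟩, h₀⟩,
            mem_coincidences.2 ⟨⟨hxA 2, hyA 2⟩, h₂⟩⟩
        · obtain ⟨hxy, hlabel⟩ := mem_filter.1 hp
          exact ⟨hxy, (Prod.mk.inj hlabel).1⟩
    _ ≤ (#A * q) ^ 2 := by
        rw [card_product, ← sq]
        exact Nat.pow_le_pow_left (card_collisions_blockIndex_le A hq) 2

theorem card_collisions_sortedTuples_le (hf : StrictConvexOn 𝕜 I f) (hA : (A : Set 𝕜) ⊆ I) {q : ℕ}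
    (hq : 0 < q) :
    #(collisions (sortedTuples 3 A) (graphSum f)) ≤
      (2 * (#A / q) + 1) * (#A ^ 3 + (#A * q) ^ 2) := by
  have hrange : ∀ x ∈ sortedTuples 3 A, endsIndex A q x ∈ range (2 * (#A / q) + 1) :=
    fun x _ => endsIndex_mem_range A q x
  have h := card_collisions_le_mul_sum (graphSum f) hrange
  rw [sum_card_collisions_filter _ hrange, card_range] at h
  exact h.trans <| Nat.mul_le_mul_left _ <| (card_collisions_eq_card_add_offDiag _ _).trans_le <|
    Nat.add_le_add (card_sortedTuples_le 3 A) (card_offDiag_sortedTuples_le hf hA hq)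

end GraphSums

section RealGraphs

/-- With blocks of length about `√N` the two terms in the second factor are comparable. -/
theorem two_mul_div_add_one_mul_le_rpow (N : ℕ) :
    (((2 * (N / (N.sqrt + 1)) + 1) * (N ^ 3 + (N * (N.sqrt + 1)) ^ 2) : ℕ) : ℝ) ≤
      15 * (N : ℝ) ^ (7 / 2 : ℝ) := by
  rcases N.eq_zero_or_pos with rfl | hN
  · simp
  set r := √(N : ℝ) with hr
  set q : ℝ := (N.sqrt : ℝ) + 1 with hq
  have hr_sq : (N : ℝ) = r ^ 2 := (Real.sq_sqrt N.cast_nonneg).symm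
  have hr_one : 1 ≤ r := Real.one_le_sqrt.2 (mod_cast hN)
  have hrq : r ≤ q := Real.real_sqrt_le_nat_sqrt_succ
  have hqr : q ≤ 2 * r := by linarith [Real.nat_sqrt_le_real_sqrt (a := N)]
  have hdiv : ((N / (N.sqrt + 1) : ℕ) : ℝ) ≤ r :=
    calc ((N / (N.sqrt + 1) : ℕ) : ℝ) ≤ N / q :=
          Nat.cast_div_le.trans_eq (by rw [hq, Nat.cast_succ])
      _ ≤ N / r := by gcongr
      _ = r := by rw [hr_sq, sq, mul_self_div_self]
  have hpow : (N : ℝ) ^ (7 / 2 : ℝ) = r ^ 7 := by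
    rw [hr_sq, ← Real.rpow_natCast_mul (Real.sqrt_nonneg _), ← Real.rpow_natCast r 7]
    norm_num [hr]
  push_cast
  rw [hpow, hr_sq]
  calc (2 * ((N / (N.sqrt + 1) : ℕ) : ℝ) + 1) * ((r ^ 2) ^ 3 + (r ^ 2 * q) ^ 2)
      ≤ (2 * r + r) * ((r ^ 2) ^ 3 + (r ^ 2 * (2 * r)) ^ 2) := by gcongr
    _ = 15 * r ^ 7 := by ring

variable {I : Set ℝ} {f : ℝ → ℝ} {A : Finset ℝ}

theorem card_collisions_graphSum_le_of_strictConvexOn (hf : StrictConvexOn ℝ I f)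
    (hA : (A : Set ℝ) ⊆ I) :
    (#(collisions (Fintype.piFinset fun _ : Fin 3 => A) (graphSum f)) : ℝ) ≤
      540 * (#A : ℝ) ^ (7 / 2 : ℝ) := by
  have hsorted := card_collisions_piFinset_le_sortedTuples A (graphSum_comp_perm (n := 3) f)
  have hblocks := card_collisions_sortedTuples_le hf hA (Nat.succ_pos (#A).sqrt)
  calc (#(collisions (Fintype.piFinset fun _ : Fin 3 => A) (graphSum f)) : ℝ)
      ≤ 36 * ((2 * (#A / ((#A).sqrt + 1)) + 1) * (#A ^ 3 + (#A * ((#A).sqrt + 1)) ^ 2) : ℕ) :=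
        mod_cast hsorted.trans (Nat.mul_le_mul_left _ hblocks)
    _ ≤ 36 * (15 * (#A : ℝ) ^ (7 / 2 : ℝ)) := by
        gcongr
        exact two_mul_div_add_one_mul_le_rpow #A
    _ = 540 * (#A : ℝ) ^ (7 / 2 : ℝ) := by ring

theorem card_collisions_graphSum_le (hf : StrictConvexOn ℝ I f ∨ StrictConcaveOn ℝ I f)
    (hA : (A : Set ℝ) ⊆ I) :
    (#(collisions (Fintype.piFinset fun _ : Fin 3 => A) (graphSum f)) : ℝ) ≤
      540 * (#A : ℝ) ^ (7 / 2 : ℝ) := by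
  rcases hf with hf | hf
  · exact card_collisions_graphSum_le_of_strictConvexOn hf hA
  · refine le_trans ?_ (card_collisions_graphSum_le_of_strictConvexOn hf.neg hA)
    refine mod_cast card_collisions_le_of_injOn id (Set.mapsTo_id _) (Set.injOn_id _)
      fun x _ y _ hxy => ?_
    obtain ⟨hsum, hfsum⟩ := Prod.mk.inj hxy
    exact Prod.ext hsum (by simp only [graphSum, id, Pi.neg_apply, sum_neg_distrib, hfsum])

end RealGraphs

section Arcs

/-- A strictly convex arc: a set contained in the graph of a strictly convex or strictly concave
function over a set of abscissae. -/
def IsStrictlyConvexArc (S : Set (EuclideanSpace ℝ (Fin 2))) : Prop :=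
  ∃ (I : Set ℝ) (f : ℝ → ℝ), (StrictConvexOn ℝ I f ∨ StrictConcaveOn ℝ I f) ∧
    ∀ x ∈ S, x 0 ∈ I ∧ x 1 = f (x 0)

theorem kEnergy_eq_card_collisions {n : ℕ} (k : ℕ) (Λ : Finset (EuclideanSpace ℝ (Fin n))) :
    kEnergy k Λ =
      #(collisions (Fintype.piFinset fun _ : Fin k => Λ) fun x => ∑ i, x i) := by
  rw [kEnergy, ← Set.ncard_coe_finset]
  congr 1
  ext p
  simp only [Set.mem_ofPred_eq, mem_coe, mem_coincidences, Fintype.mem_piFinset, and_assoc]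

theorem mixedEnergy_le_of_isStrictlyConvexArc {S : Set (EuclideanSpace ℝ (Fin 2))}
    (hS : IsStrictlyConvexArc S) {Λ : Finset (EuclideanSpace ℝ (Fin 2))} (hΛ : (Λ : Set _) ⊆ S) :
    (mixedEnergy (fun _ => Λ) : ℝ) ≤ 540 * (#Λ : ℝ) ^ (7 / 2 : ℝ) := by
  obtain ⟨I, f, hf, hSf⟩ := hS
  have hgraph : ∀ v ∈ Λ, v 0 ∈ I ∧ v 1 = f (v 0) := fun v hv => hSf v (hΛ hv)
  have hinj : Set.InjOn (fun v : EuclideanSpace ℝ (Fin 2) => v 0) Λ := fun v hv w hw h => by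
    ext i
    fin_cases i
    exacts [h, ((hgraph v hv).2.trans (congrArg f h)).trans (hgraph w hw).2.symm]
  have hA : ((Λ.image fun v => v 0 : Finset ℝ) : Set ℝ) ⊆ I := by
    rw [coe_image, Set.image_subset_iff]
    exact fun v hv => (hgraph v hv).1
  have hproj : mixedEnergy (fun _ => Λ) ≤
      #(collisions (Fintype.piFinset fun _ : Fin 3 => Λ.image fun v => v 0) (graphSum f)) := by
    refine card_collisions_le_of_injOn (fun x i => x i 0) (fun x hx => ?_) (fun x hx y hy h => ?_)
      fun x hx y hy h => ?_
    · exact Fintype.mem_piFinset.2 fun i => mem_image_of_mem _ (Fintype.mem_piFinset.1 hx i)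
    · exact funext fun i => hinj (Fintype.mem_piFinset.1 hx i) (Fintype.mem_piFinset.1 hy i)
        (congrFun h i)
    · have hcoord (j : Fin 2) : ∑ i, x i j = ∑ i, y i j := by
        simpa only [WithLp.ofLp_sum, Finset.sum_apply] using congrArg (fun v => v j) h
      have hx₁ (i : Fin 3) : x i 1 = f (x i 0) := (hgraph _ (Fintype.mem_piFinset.1 hx i)).2
      have hy₁ (i : Fin 3) : y i 1 = f (y i 0) := (hgraph _ (Fintype.mem_piFinset.1 hy i)).2
      exact Prod.ext (hcoord 0) (by simpa only [graphSum, hx₁, hy₁] using hcoord 1)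
  calc (mixedEnergy (fun _ => Λ) : ℝ)
      ≤ 540 * (#(Λ.image fun v => v 0) : ℝ) ^ (7 / 2 : ℝ) :=
        (Nat.cast_le.2 hproj).trans (card_collisions_graphSum_le hf hA)
    _ ≤ 540 * (#Λ : ℝ) ^ (7 / 2 : ℝ) := by
        gcongr
        exact card_image_le

theorem isStrictlyConvexArc_truncatedParabola : IsStrictlyConvexArc truncatedParabola :=
  ⟨Set.univ, fun t => t ^ 2, Or.inl (even_two.strictConvexOn_pow two_ne_zero),
    fun _ hx => ⟨Set.mem_univ _, hx.2⟩⟩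

theorem strictConcaveOn_sqrt_one_sub_sq :
    StrictConcaveOn ℝ (Set.Icc (-1) 1) fun t : ℝ => √(1 - t ^ 2) := by
  refine ⟨convex_Icc _ _, fun x hx y hy hxy a b ha hb hab => ?_⟩
  have hx_nonneg : 0 ≤ 1 - x ^ 2 := by nlinarith [hx.1, hx.2]
  have hy_nonneg : 0 ≤ 1 - y ^ 2 := by nlinarith [hy.1, hy.2]
  have hsq : (a * x + b * y) ^ 2 < a * x ^ 2 + b * y ^ 2 :=
    (even_two.strictConvexOn_pow two_ne_zero).2 (Set.mem_univ x) (Set.mem_univ y) hxy ha hb hab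
  calc a * √(1 - x ^ 2) + b * √(1 - y ^ 2)
      ≤ √(a * (1 - x ^ 2) + b * (1 - y ^ 2)) :=
        Real.strictConcaveOn_sqrt.concaveOn.2 hx_nonneg hy_nonneg ha.le hb.le hab
    _ < √(1 - (a * x + b * y) ^ 2) := Real.sqrt_lt_sqrt (by positivity) (by linarith)

theorem mem_unitCircle_iff {x : EuclideanSpace ℝ (Fin 2)} :
    x ∈ unitCircle ↔ x 0 ^ 2 + x 1 ^ 2 = 1 := by
  rw [unitCircle, mem_sphere_zero_iff_norm, ← sq_eq_sq₀ (norm_nonneg x) zero_le_one,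
    EuclideanSpace.real_norm_sq_eq, Fin.sum_univ_two, one_pow]

theorem abs_eq_sqrt_of_mem_unitCircle {x : EuclideanSpace ℝ (Fin 2)} (hx : x ∈ unitCircle) :
    x 0 ∈ Set.Icc (-1) 1 ∧ |x 1| = √(1 - x 0 ^ 2) := by
  rw [mem_unitCircle_iff] at hx
  refine ⟨abs_le.1 ((sq_le_one_iff_abs_le_one _).1 (by nlinarith [sq_nonneg (x 1)])), ?_⟩
  rw [← Real.sqrt_sq_eq_abs]
  congr 1
  linarith

theorem isStrictlyConvexArc_upperSemicircle : IsStrictlyConvexArc {x ∈ unitCircle | 0 ≤ x 1} :=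
  ⟨Set.Icc (-1) 1, fun t => √(1 - t ^ 2), Or.inr strictConcaveOn_sqrt_one_sub_sq, fun x hx => by
    obtain ⟨hI, habs⟩ := abs_eq_sqrt_of_mem_unitCircle hx.1
    exact ⟨hI, (abs_of_nonneg hx.2).symm.trans habs⟩⟩

theorem isStrictlyConvexArc_lowerSemicircle : IsStrictlyConvexArc {x ∈ unitCircle | x 1 ≤ 0} :=
  ⟨Set.Icc (-1) 1, -fun t => √(1 - t ^ 2), Or.inl strictConcaveOn_sqrt_one_sub_sq.neg,
    fun x hx => by
      obtain ⟨hI, habs⟩ := abs_eq_sqrt_of_mem_unitCircle hx.1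
      exact ⟨hI, by rw [Pi.neg_apply, ← habs, abs_of_nonpos hx.2, neg_neg]⟩⟩

theorem exists_arcs_cover {S : Set (EuclideanSpace ℝ (Fin 2))}
    (hS : S = truncatedParabola ∨ S = unitCircle) :
    ∃ T : Bool → Set (EuclideanSpace ℝ (Fin 2)),
      (∀ i, IsStrictlyConvexArc (T i)) ∧ S ⊆ ⋃ i, T i := by
  rcases hS with rfl | rfl
  · exact ⟨fun _ => truncatedParabola, fun _ => isStrictlyConvexArc_truncatedParabola,
      fun x hx => Set.mem_iUnion.2 ⟨true, hx⟩⟩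
  · refine ⟨fun i => cond i {x ∈ unitCircle | 0 ≤ x 1} {x ∈ unitCircle | x 1 ≤ 0},
      Bool.forall_bool.2
        ⟨isStrictlyConvexArc_lowerSemicircle, isStrictlyConvexArc_upperSemicircle⟩,
      fun x hx => Set.mem_iUnion.2 ?_⟩
    rcases le_total 0 (x 1) with h | h
    exacts [⟨true, hx, h⟩, ⟨false, hx, h⟩]

end Arcs

theorem natCast_rpow_le_rpow_add (N : ℕ) {a ε : ℝ} (ha : 0 < a) (hε : 0 ≤ ε) :
    (N : ℝ) ^ a ≤ (N : ℝ) ^ (a + ε) := by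
  rcases N.eq_zero_or_pos with rfl | hN
  · rw [Nat.cast_zero, Real.zero_rpow ha.ne', Real.zero_rpow (by positivity)]
  · exact Real.rpow_le_rpow_of_exponent_le (mod_cast hN) (le_add_of_nonneg_right hε)

theorem mainTheorem5_general {ι : Type*} [Fintype ι] {T : ι → Set (EuclideanSpace ℝ (Fin 2))}
    (hT : ∀ i, IsStrictlyConvexArc (T i)) {Λ : Finset (EuclideanSpace ℝ (Fin 2))}
    (hΛ : (Λ : Set _) ⊆ ⋃ i, T i) :
    (kEnergy 3 Λ : ℝ) ≤ 540 * (Fintype.card ι : ℝ) ^ 6 * (#Λ : ℝ) ^ (7 / 2 : ℝ) := by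
  classical
  rcases Λ.eq_empty_or_nonempty with rfl | ⟨v, hv⟩
  · simp [kEnergy_eq_card_collisions, collisions, coincidences]
  have : Nonempty ι := ⟨(Set.mem_iUnion.1 (hΛ hv)).choose⟩
  have hcover : ∀ x ∈ Λ, ∃ i, x ∈ T i := fun x hx => Set.mem_iUnion.1 (hΛ hx)
  choose! c hc using hcover
  have hfiber (i : ι) : mixedEnergy (fun _ => {x ∈ Λ | c x = i}) ≤
      ⌊540 * (#Λ : ℝ) ^ (7 / 2 : ℝ)⌋₊ := by
    have hsub : (({x ∈ Λ | c x = i} : Finset _) : Set (EuclideanSpace ℝ (Fin 2))) ⊆ T i := by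
      intro x hx
      obtain ⟨hxΛ, rfl⟩ := mem_filter.1 hx
      exact hc x hxΛ
    refine Nat.le_floor ((mixedEnergy_le_of_isStrictlyConvexArc (hT i) hsub).trans ?_)
    gcongr
    exact filter_subset _ _
  calc (kEnergy 3 Λ : ℝ) = mixedEnergy (fun _ => Λ) := by
        rw [kEnergy_eq_card_collisions, mixedEnergy]
    _ ≤ (Fintype.card ι : ℝ) ^ 6 * ⌊540 * (#Λ : ℝ) ^ (7 / 2 : ℝ)⌋₊ :=
        mod_cast mixedEnergy_le_of_fibers_le c hfiber
    _ ≤ (Fintype.card ι : ℝ) ^ 6 * (540 * (#Λ : ℝ) ^ (7 / 2 : ℝ)) := by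
        gcongr
        exact Nat.floor_le (by positivity)
    _ = 540 * (Fintype.card ι : ℝ) ^ 6 * (#Λ : ℝ) ^ (7 / 2 : ℝ) := by ring

theorem mainTheorem5 (S : Set (EuclideanSpace ℝ (Fin 2)))
    (hS : S = truncatedParabola ∨ S = unitCircle) (ε : ℝ) (hε : 0 < ε) :
    ∃ C : ℝ, 0 < C ∧ ∀ Λ : Finset (EuclideanSpace ℝ (Fin 2)), (Λ : Set _) ⊆ S →
      (kEnergy 3 Λ : ℝ) ≤ C * (Λ.card : ℝ) ^ (7 / 2 + ε) := by
  obtain ⟨T, hT, hST⟩ := exists_arcs_cover hS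
  exact ⟨540 * (Fintype.card Bool : ℝ) ^ 6, by positivity, fun Λ hΛ =>
    (mainTheorem5_general hT (hΛ.trans hST)).trans <|
      mul_le_mul_of_nonneg_left (natCast_rpow_le_rpow_add _ (by norm_num) hε.le) (by positivity)⟩
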